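/- Let $f:\mathbb{R}^n\to\mathbb{R}$ be three times continuously differentiable, with gradient $G=\nabla f$ and Hessian $H=\nabla^2 f$. Let $x^*$ be a local (in particular, possibly global) minimizer of $f$, and suppose that there are $\rho>0$ and $\Lambda_2>0$ such that $v^{T}H(x)v\ge\Lambda_2\|v\|_2^2$ for all $v\in\mathbb{R}^n$ and all $x$ in the open ball $B_\rho(x^*)$. For $\alpha>0$ and $x_{\rm new}=x-\alpha G(x)$ define the long and the short KGD step-sizes $$\mathcal{K}_1(x_{\rm new};x,\alpha)=\frac{\alpha}{2+\frac{2(f(x_{\rm new})-f(x))}{\alpha\|G(x)\|_2^2}},\qquad \mathcal{K}_1^{\rm s}(x_{\rm new};x,\alpha)=\frac{2\left(\alpha\|G(x)\|_2^2+f(x_{\rm new})-f(x)\right)}{\|G(x_{\rm new})-G(x)\|_2^2}.$$ Let $\mathsf{K}_1$ be either $\mathcal{K}_1$ or $\mathcal{K}_1^{\rm s}$, and, given $x_0\in\mathbb{R}^n$ and $\alpha_0>0$, consider the iteration $$x_{k+1}=x_k-\alpha_kG(x_k),\qquad \alpha_{k+1}=\mathsf{K}_1(x_{k+1};x_k,\alpha_k),\qquad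 k\ge 0,$$ which is regarded as terminated, with all later iterates equal to $x_k$, as soon as $G(x_k)=0$. Then there is a number $r$ with $0<r<\rho$ such that the following holds for every $0<\delta<r$: whenever $x_0,x_1\in B_\delta(x^*)$ and the sublevel set $\{y\in\mathbb{R}^n: f(y)\le f(x_0)\}$ is compact, the sequence $\{x_k\}$ converges to $x^*$ at least R-linearly, that is, $x_k\to x^*$ and there are constants $C$ and $c\in(0,1)$, which may depend on the sequence, with $\|x_k-x^*\|_2\le C\,c^k$ for all $k\ge 0$. -/

import Mathlib

open Filter Topology

noncomputable section

/-- The Hessian of `f` at `x`, as a linear operator: the derivative of the gradient. -/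
def hessian {n : ℕ} (f : EuclideanSpace ℝ (Fin n) → ℝ) (x : EuclideanSpace ℝ (Fin n)) :
    EuclideanSpace ℝ (Fin n) →L[ℝ] EuclideanSpace ℝ (Fin n) :=
  fderiv ℝ (gradient f) x

/-- The long KGD step-size for `xnew` (where `xnew = x - α ∇f(x)`). -/
def longKGD {n : ℕ} (f : EuclideanSpace ℝ (Fin n) → ℝ)
    (xnew x : EuclideanSpace ℝ (Fin n)) (α : ℝ) : ℝ :=
  α / (2 + 2 * (f xnew - f x) / (α * ‖gradient f x‖ ^ 2))

/-- The short KGD step-size for `xnew` (where `xnew = x - α ∇f(x)`). -/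
def shortKGD {n : ℕ} (f : EuclideanSpace ℝ (Fin n) → ℝ)
    (xnew x : EuclideanSpace ℝ (Fin n)) (α : ℝ) : ℝ :=
  2 * (α * ‖gradient f x‖ ^ 2 + (f xnew - f x)) / ‖gradient f xnew - gradient f x‖ ^ 2

/-- The choice between the long and the short step-size. -/
inductive KGDKind
  | long
  | short

/-- The step-size operator of the chosen kind. -/
def kgdStep {n : ℕ} (f : EuclideanSpace ℝ (Fin n) → ℝ) :
    KGDKind → EuclideanSpace ℝ (Fin n) → EuclideanSpace ℝ (Fin n) → ℝ → ℝ
  | KGDKind.long => longKGD f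
  | KGDKind.short => shortKGD f

/-- `x` and `α` are the iterates and step-sizes of the KGD iteration of the given kind.
The step-size formulas are `0 / 0` once the gradient vanishes, so the update of the step-size
is only imposed while `∇f(x k) ≠ 0`. If `∇f(x k) = 0` the method has terminated: the first
equation then keeps the iterates constant, whatever the later step-sizes are. -/
structure IsKGDIteration {n : ℕ} (f : EuclideanSpace ℝ (Fin n) → ℝ) (kind : KGDKind)
    (x : ℕ → EuclideanSpace ℝ (Fin n)) (α : ℕ → ℝ) : Prop where
  init_pos : 0 < α 0
  iterate : ∀ k, x (k + 1) = x k - α k • gradient f (x k)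
  stepsize : ∀ k, gradient f (x k) ≠ 0 →
    α (k + 1) = kgdStep f kind (x (k + 1)) (x k) (α k)

/-- `x` converges to `a` at least R-linearly. -/
def ConvergesRLinearly {n : ℕ} (x : ℕ → EuclideanSpace ℝ (Fin n))
    (a : EuclideanSpace ℝ (Fin n)) : Prop :=
  Tendsto x atTop (𝓝 a) ∧
    ∃ C c : ℝ, 0 < c ∧ c < 1 ∧ ∀ k, ‖x k - a‖ ≤ C * c ^ k

end

open scoped InnerProductSpace

/-! ### Spectral estimates for perturbed Barzilai–Borwein step-sizes. -/

section Spectral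

variable {ι V : Type*} [Fintype ι] [NormedAddCommGroup V] [InnerProductSpace ℝ V]

/-! Let e_k = x_k - x*, s = x_{k+1} - x_k, and let A be the Hessian at x*. By Taylor, 2(α‖G‖² +
f(x_new) - f(x)) equals ⟪s, A s⟫ up to a small multiple of ‖s‖². Both step-sizes are therefore
perturbed Barzilai–Borwein steps, formed from s and used one iteration later
(`isNearSpectralStep_kgdStep`). What remains concerns such delayed gradient recursions only:
`DiagonalizedBy.exists_linear_rate`.

The error norm need not decrease at each step, so the argument runs by components in an eigenbasis
of A, with invariant |e_{k,l}| ≤ c_l θ^k E and weights c_l that grow steeply with the eigenvalue. If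
component l at time k is tiny against its bound, two steps of bounded growth cannot break the bound
at k + 2. Otherwise it dominates all components of smaller eigenvalue; G(e_k), hence s, inherits
this (`DiagonalizedBy.slowEnergy_le_of_dominant`), and the step-size, a reciprocal average of
eigenvalues weighted by s, is not much above 1/λ_l (`IsNearSpectralStep.mul_eigenvalue_le`).
Component l then contracts in the step from k + 1 to k + 2. -/

theorem abs_repr_le_norm (b : OrthonormalBasis ι ℝ V) (v : V) (i : ι) :
    |b.repr v i| ≤ ‖v‖ := by
  rw [b.repr_apply_apply]
  simpa using abs_real_inner_le_norm (b i) v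

theorem norm_le_sum_abs_repr (b : OrthonormalBasis ι ℝ V) (v : V) :
    ‖v‖ ≤ ∑ i, |b.repr v i| := by
  calc ‖v‖ = ‖∑ i, b.repr v i • b i‖ := by rw [b.sum_repr]
    _ ≤ ∑ i, ‖b.repr v i • b i‖ := norm_sum_le _ _
    _ = ∑ i, |b.repr v i| := by simp [norm_smul]

theorem norm_sq_eq_sum_repr_sq (b : OrthonormalBasis ι ℝ V) (v : V) :
    ‖v‖ ^ 2 = ∑ i, (b.repr v i) ^ 2 := by
  rw [← b.repr.norm_map v, EuclideanSpace.norm_sq_eq]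
  simp

theorem inner_eq_sum_repr_mul (b : OrthonormalBasis ι ℝ V) (v w : V) :
    ⟪v, w⟫_ℝ = ∑ i, b.repr v i * b.repr w i := by
  rw [← b.repr.inner_map_map v w, PiLp.inner_apply]
  simp [mul_comm]

/-- The squared length of the component of `v` along the basis vectors whose eigenvalue is
smaller than that of the `l`-th one. -/
noncomputable def slowEnergy (b : OrthonormalBasis ι ℝ V) (lam : ι → ℝ) (l : ι) (v : V) : ℝ :=
  ∑ i with lam i < lam l, (b.repr v i) ^ 2

theorem slowEnergy_smul (b : OrthonormalBasis ι ℝ V) (lam : ι → ℝ) (l : ι) (t : ℝ) (v : V) :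
    slowEnergy b lam l (t • v) = t ^ 2 * slowEnergy b lam l v := by
  simp [slowEnergy, mul_pow, Finset.mul_sum]

theorem slowEnergy_eq_sum_ite (b : OrthonormalBasis ι ℝ V) (lam : ι → ℝ) (l : ι) (v : V) :
    slowEnergy b lam l v = ∑ i, if lam i < lam l then (b.repr v i) ^ 2 else 0 := by
  rw [slowEnergy, Finset.sum_filter]

/-- `A` is diagonal in the orthonormal basis `b`, with eigenvalues `lam` in `[μ, L]`. -/
structure DiagonalizedBy (A : V →L[ℝ] V) (b : OrthonormalBasis ι ℝ V) (lam : ι → ℝ)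
    (μ L : ℝ) : Prop where
  repr_apply : ∀ v i, b.repr (A v) i = lam i * b.repr v i
  le_eigenvalue : ∀ i, μ ≤ lam i
  eigenvalue_le : ∀ i, lam i ≤ L

namespace DiagonalizedBy

variable {A : V →L[ℝ] V} {b : OrthonormalBasis ι ℝ V} {lam : ι → ℝ} {μ L : ℝ}

theorem inner_eq (hA : DiagonalizedBy A b lam μ L) (v : V) :
    ⟪v, A v⟫_ℝ = ∑ i, lam i * (b.repr v i) ^ 2 := by
  rw [inner_eq_sum_repr_mul b]
  refine Finset.sum_congr rfl fun i _ => ?_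
  rw [hA.repr_apply]; ring

theorem norm_sq_eq (hA : DiagonalizedBy A b lam μ L) (v : V) :
    ‖A v‖ ^ 2 = ∑ i, lam i ^ 2 * (b.repr v i) ^ 2 := by
  rw [norm_sq_eq_sum_repr_sq b]
  refine Finset.sum_congr rfl fun i _ => ?_
  rw [hA.repr_apply]; ring

theorem mul_norm_sq_le_inner (hA : DiagonalizedBy A b lam μ L) (v : V) :
    μ * ‖v‖ ^ 2 ≤ ⟪v, A v⟫_ℝ := by
  rw [hA.inner_eq, norm_sq_eq_sum_repr_sq b, Finset.mul_sum]
  exact Finset.sum_le_sum fun i _ =>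
    mul_le_mul_of_nonneg_right (hA.le_eigenvalue i) (sq_nonneg _)

theorem inner_le_mul_norm_sq (hA : DiagonalizedBy A b lam μ L) (v : V) :
    ⟪v, A v⟫_ℝ ≤ L * ‖v‖ ^ 2 := by
  rw [hA.inner_eq, norm_sq_eq_sum_repr_sq b, Finset.mul_sum]
  exact Finset.sum_le_sum fun i _ =>
    mul_le_mul_of_nonneg_right (hA.eigenvalue_le i) (sq_nonneg _)

theorem mul_norm_le_norm (hA : DiagonalizedBy A b lam μ L) (hμ : 0 < μ) (v : V) :
    μ * ‖v‖ ≤ ‖A v‖ := by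
  refine le_of_sq_le_sq ?_ (norm_nonneg _)
  rw [mul_pow, hA.norm_sq_eq, norm_sq_eq_sum_repr_sq b, Finset.mul_sum]
  exact Finset.sum_le_sum fun i _ => mul_le_mul_of_nonneg_right
    (pow_le_pow_left₀ hμ.le (hA.le_eigenvalue i) 2) (sq_nonneg _)

theorem norm_le_mul_norm (hA : DiagonalizedBy A b lam μ L) (hμ : 0 < μ) (hL : 0 ≤ L) (v : V) :
    ‖A v‖ ≤ L * ‖v‖ := by
  refine le_of_sq_le_sq ?_ (by positivity)
  rw [mul_pow, hA.norm_sq_eq, norm_sq_eq_sum_repr_sq b, Finset.mul_sum]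
  exact Finset.sum_le_sum fun i _ => mul_le_mul_of_nonneg_right
    (pow_le_pow_left₀ (hμ.le.trans (hA.le_eigenvalue i)) (hA.eigenvalue_le i) 2) (sq_nonneg _)

/-- The slow components contribute nonnegatively to the quadratic form and are dropped. Used for the
long step. -/
theorem eigenvalue_mul_norm_sq_le (hA : DiagonalizedBy A b lam μ L) (hμ : 0 < μ) (l : ι) (v : V) :
    lam l * (‖v‖ ^ 2 - slowEnergy b lam l v) ≤ ⟪v, A v⟫_ℝ := by
  rw [hA.inner_eq, norm_sq_eq_sum_repr_sq b, slowEnergy_eq_sum_ite, ← Finset.sum_sub_distrib,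
    Finset.mul_sum]
  refine Finset.sum_le_sum fun i _ => ?_
  have hi := hA.le_eigenvalue i
  split_ifs with h
  · have : 0 ≤ lam i * (b.repr v i) ^ 2 := mul_nonneg (by linarith) (sq_nonneg _)
    simpa using this
  · rw [sub_zero]
    exact mul_le_mul_of_nonneg_right (not_lt.1 h) (sq_nonneg _)

/-- Off the slow part λ_l λ_i ≤ λ_i²; on it λ_l λ_i ≤ λ_l², which the slow energy pays for. Used for
the short step. -/
theorem eigenvalue_mul_inner_le (hA : DiagonalizedBy A b lam μ L) (hμ : 0 < μ) (l : ι) (v : V) :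
    lam l * ⟪v, A v⟫_ℝ ≤ ‖A v‖ ^ 2 + lam l ^ 2 * slowEnergy b lam l v := by
  rw [hA.inner_eq, hA.norm_sq_eq, slowEnergy_eq_sum_ite, Finset.mul_sum, Finset.mul_sum,
    ← Finset.sum_add_distrib]
  refine Finset.sum_le_sum fun i _ => ?_
  have hi := hA.le_eigenvalue i
  have hl := hA.le_eigenvalue l
  split_ifs with h
  · nlinarith [mul_nonneg (add_nonneg (sq_nonneg (lam l - lam i))
      (mul_nonneg (hμ.le.trans hi) (hμ.le.trans hl))) (sq_nonneg (b.repr v i))]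
  · have h0 : 0 ≤ lam i * (lam i - lam l) := mul_nonneg (by linarith) (by linarith [not_lt.1 h])
    nlinarith [mul_nonneg h0 (sq_nonneg (b.repr v i))]

theorem eigenvalue_sq_mul_le (hA : DiagonalizedBy A b lam μ L) (l : ι) (v : V) :
    lam l ^ 2 * (b.repr v l) ^ 2 ≤ ‖A v‖ ^ 2 := by
  rw [hA.norm_sq_eq]
  exact Finset.single_le_sum (f := fun i => lam i ^ 2 * (b.repr v i) ^ 2)
    (fun i _ => by positivity) (Finset.mem_univ l)

end DiagonalizedBy

/-- `t` is a perturbed spectral step-size for the displacement `s`: up to a relative error `ε`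
it is `‖s‖² / ⟪s, A s⟫` or `⟪s, A s⟫ / ‖A s‖²`. -/
def IsNearSpectralStep (A : V →L[ℝ] V) (ε : ℝ) (s : V) (t : ℝ) : Prop :=
  ∃ q : ℝ, ∃ y : V, |q - ⟪s, A s⟫_ℝ| ≤ ε * ‖s‖ ^ 2 ∧ ‖y - A s‖ ≤ ε * ‖s‖ ∧
    (t = ‖s‖ ^ 2 / q ∨ t = q / ‖y‖ ^ 2)

namespace IsNearSpectralStep

variable {A : V →L[ℝ] V} {b : OrthonormalBasis ι ℝ V} {lam : ι → ℝ} {μ L ε t : ℝ} {s : V}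

/-- The perturbation worsens the spectral bounds on q and ‖y‖ by at most a factor two; the constants
are not sharp and serve both quotients. -/
theorem mem_Icc (h : IsNearSpectralStep A ε s t) (hA : DiagonalizedBy A b lam μ L) (hμ : 0 < μ)
    (hμL : μ ≤ L) (hε : ε ≤ μ / 2) (hs : s ≠ 0) :
    t ∈ Set.Icc (μ / (8 * L ^ 2)) (8 * L / μ ^ 2) := by
  obtain ⟨q, y, hq, hy, ht⟩ := h
  have hL : 0 < L := hμ.trans_le hμL
  have hN : 0 < ‖s‖ := norm_pos_iff.2 hs
  have hN2 : 0 < ‖s‖ ^ 2 := by positivity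
  have h1 := hA.mul_norm_sq_le_inner s
  have h2 := hA.inner_le_mul_norm_sq s
  have h3 := hA.mul_norm_le_norm hμ s
  have h4 := hA.norm_le_mul_norm hμ hL.le s
  have hε2 : ε * ‖s‖ ^ 2 ≤ μ / 2 * ‖s‖ ^ 2 := by gcongr
  have hε1 : ε * ‖s‖ ≤ μ / 2 * ‖s‖ := by gcongr
  rw [abs_le] at hq
  have hq1 : μ / 2 * ‖s‖ ^ 2 ≤ q := by linarith
  have hq2 : q ≤ 2 * L * ‖s‖ ^ 2 := by nlinarith
  have hq0 : 0 < q := lt_of_lt_of_le (by positivity) hq1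
  have hy1 : μ / 2 * ‖s‖ ≤ ‖y‖ := by
    have := norm_sub_norm_le (A s) y
    rw [norm_sub_rev] at this
    linarith
  have hy2 : ‖y‖ ≤ 2 * L * ‖s‖ := by
    have := norm_sub_norm_le y (A s)
    nlinarith
  have hy0 : 0 < ‖y‖ := lt_of_lt_of_le (by positivity) hy1
  have hy1' : μ ^ 2 / 4 * ‖s‖ ^ 2 ≤ ‖y‖ ^ 2 := by
    calc μ ^ 2 / 4 * ‖s‖ ^ 2 = (μ / 2 * ‖s‖) ^ 2 := by ring
      _ ≤ _ := by gcongr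
  have hy2' : ‖y‖ ^ 2 ≤ 4 * L ^ 2 * ‖s‖ ^ 2 := by
    calc ‖y‖ ^ 2 ≤ (2 * L * ‖s‖) ^ 2 := by gcongr
      _ = _ := by ring
  rw [Set.mem_Icc]
  rcases ht with rfl | rfl
  · rw [div_le_div_iff₀ (by positivity) hq0, div_le_div_iff₀ hq0 (by positivity)]
    constructor
    · calc μ * q ≤ L * (2 * L * ‖s‖ ^ 2) := by gcongr
        _ ≤ ‖s‖ ^ 2 * (8 * L ^ 2) := by nlinarith [mul_pos hN2 (pow_pos hL 2)]
    · calc ‖s‖ ^ 2 * μ ^ 2 = 2 * μ * (μ / 2 * ‖s‖ ^ 2) := by ring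
        _ ≤ 8 * L * q := by gcongr; linarith
  · rw [div_le_div_iff₀ (by positivity) (by positivity),
      div_le_div_iff₀ (by positivity) (by positivity)]
    constructor
    · calc μ * ‖y‖ ^ 2 ≤ μ * (4 * L ^ 2 * ‖s‖ ^ 2) := by gcongr
        _ = μ / 2 * ‖s‖ ^ 2 * (8 * L ^ 2) := by ring
        _ ≤ _ := by gcongr
    · calc q * μ ^ 2 ≤ 2 * L * ‖s‖ ^ 2 * μ ^ 2 := by gcongr
        _ = 8 * L * (μ ^ 2 / 4 * ‖s‖ ^ 2) := by ring
        _ ≤ _ := by gcongr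

/-- With little slow energy, the average of eigenvalues in the step is nearly at least λ_l. The
value 3/2 leaves a margin below 2, so that 1 - tλ_l ≥ -1/2. -/
theorem mul_eigenvalue_le (h : IsNearSpectralStep A ε s t) (hA : DiagonalizedBy A b lam μ L)
    (hμ : 0 < μ) (hε : ε ≤ μ / 16) (hs : s ≠ 0) {l : ι}
    (hl : slowEnergy b lam l s ≤ (b.repr s l) ^ 2 / 16) :
    t * lam l ≤ 3 / 2 := by
  obtain ⟨q, y, hq, hy, ht⟩ := h
  have hN : 0 < ‖s‖ := norm_pos_iff.2 hs
  have hN2 : 0 < ‖s‖ ^ 2 := by positivity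
  have hlam := hA.le_eigenvalue l
  have hlam0 : 0 < lam l := hμ.trans_le hlam
  have h1 := hA.mul_norm_sq_le_inner s
  have h3 := hA.mul_norm_le_norm hμ s
  have hε2 : ε * ‖s‖ ^ 2 ≤ μ / 16 * ‖s‖ ^ 2 := by gcongr
  have hε1 : ε * ‖s‖ ≤ μ / 16 * ‖s‖ := by gcongr
  rw [abs_le] at hq
  have hq0 : 0 < q := by nlinarith
  have hy1 : 15 / 16 * ‖A s‖ ≤ ‖y‖ := by
    have := norm_sub_norm_le (A s) y
    rw [norm_sub_rev] at this
    linarith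
  have hy0 : 0 < ‖y‖ := by nlinarith
  rcases ht with rfl | rfl
  · have hsl : (b.repr s l) ^ 2 ≤ ‖s‖ ^ 2 := by
      rw [← sq_abs]; gcongr; exact abs_repr_le_norm b s l
    have h5 := hA.eigenvalue_mul_norm_sq_le hμ l s
    have h6 : lam l * (15 / 16 * ‖s‖ ^ 2) ≤ ⟪s, A s⟫_ℝ :=
      le_trans (by gcongr; linarith) h5
    have h7 : μ * ‖s‖ ^ 2 ≤ lam l * ‖s‖ ^ 2 := by gcongr
    rw [div_mul_eq_mul_div, div_le_iff₀ hq0]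
    nlinarith
  · have h5 := hA.eigenvalue_mul_inner_le hμ l s
    have h6 := hA.eigenvalue_sq_mul_le l s
    have h7 : lam l ^ 2 * slowEnergy b lam l s ≤ ‖A s‖ ^ 2 / 16 := by
      calc lam l ^ 2 * slowEnergy b lam l s ≤ lam l ^ 2 * ((b.repr s l) ^ 2 / 16) := by gcongr
        _ ≤ _ := by linarith
    have h8 : q ≤ 17 / 16 * ⟪s, A s⟫_ℝ := by linarith
    have h9 : 225 / 256 * ‖A s‖ ^ 2 ≤ ‖y‖ ^ 2 := by
      calc 225 / 256 * ‖A s‖ ^ 2 = (15 / 16 * ‖A s‖) ^ 2 := by ring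
        _ ≤ _ := by gcongr
    have h10 : lam l * q ≤ lam l * (17 / 16 * ⟪s, A s⟫_ℝ) := by gcongr
    rw [div_mul_eq_mul_div, div_le_iff₀ (by positivity)]
    nlinarith [sq_nonneg ‖A s‖]

end IsNearSpectralStep

end Spectral

/-! ### R-linear decay of the perturbed gradient recursion. -/

section Recursion

variable {ι V : Type*} [Fintype ι] [NormedAddCommGroup V] [InnerProductSpace ℝ V]
  {A : V →L[ℝ] V} {b : OrthonormalBasis ι ℝ V} {lam : ι → ℝ} {μ L : ℝ}

theorem DiagonalizedBy.abs_repr_sub_smul_le (hA : DiagonalizedBy A b lam μ L) {e g : V} {t D : ℝ}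
    (ht : 0 ≤ t) (hD : ‖g - A e‖ ≤ D) (l : ι) :
    |b.repr (e - t • g) l| ≤ |1 - t * lam l| * |b.repr e l| + t * D := by
  have h1 : b.repr (e - t • g) l =
      (1 - t * lam l) * b.repr e l - t * b.repr (g - A e) l := by
    simp only [map_sub, map_smul, PiLp.sub_apply, PiLp.smul_apply, smul_eq_mul, hA.repr_apply]
    ring
  have h2 : |b.repr (g - A e) l| ≤ D := (abs_repr_le_norm b _ l).trans hD
  calc |b.repr (e - t • g) l|
      ≤ |(1 - t * lam l) * b.repr e l| + |t * b.repr (g - A e) l| := by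
        rw [h1]; exact abs_sub _ _
    _ = |1 - t * lam l| * |b.repr e l| + t * |b.repr (g - A e) l| := by
        rw [abs_mul, abs_mul, abs_of_nonneg ht]
    _ ≤ _ := by gcongr

/-- Applying A only strengthens the dominance of component l over those of smaller eigenvalue, and
the error D is below the scale λ_l p U. The factor card + 1 in p pays for summing the slow
components. -/
theorem DiagonalizedBy.slowEnergy_le_of_dominant (hA : DiagonalizedBy A b lam μ L) (hμ : 0 < μ)
    {e g : V} {l : ι} {τ U p D : ℝ} (hτ : 0 < τ) (hU : 0 < U)
    (hp : p = τ / (16 * (Fintype.card ι + 1))) (hD : ‖g - A e‖ ≤ D) (hDU : D ≤ μ * (p * U))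
    (hlow : ∀ j, lam j < lam l → |b.repr e j| ≤ p * U) (hl : τ * U ≤ |b.repr e l|) :
    slowEnergy b lam l g ≤ (b.repr g l) ^ 2 / 16 := by
  set N : ℝ := (Fintype.card ι : ℝ) with hN
  have hN0 : 0 ≤ N := by positivity
  have hp0 : 0 < p := by rw [hp]; positivity
  have hpτ : p * (16 * (N + 1)) = τ := by rw [hp]; field_simp
  have hpτ' : 16 * p ≤ τ := by nlinarith [mul_nonneg hp0.le hN0]
  have hlam := hA.le_eigenvalue l
  have hlam0 : 0 < lam l := hμ.trans_le hlam
  have hpU : 0 < p * U := by positivity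
  have herr : ∀ j, |b.repr g j - lam j * b.repr e j| ≤ lam l * (p * U) := by
    intro j
    have := (abs_repr_le_norm b (g - A e) j).trans hD
    rw [map_sub, PiLp.sub_apply, hA.repr_apply] at this
    refine this.trans (hDU.trans ?_)
    gcongr
  have hlowg : ∀ j, lam j < lam l → (b.repr g j) ^ 2 ≤ (2 * (lam l * (p * U))) ^ 2 := by
    intro j hj
    rw [← sq_abs]
    have hj0 : 0 < lam j := hμ.trans_le (hA.le_eigenvalue j)
    have h1 : |lam j * b.repr e j| ≤ lam l * (p * U) := by
      rw [abs_mul, abs_of_pos hj0]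
      exact mul_le_mul hj.le (hlow j hj) (abs_nonneg _) hlam0.le
    have h2 := abs_sub_abs_le_abs_sub (b.repr g j) (lam j * b.repr e j)
    have h3 := herr j
    gcongr
    linarith
  have hgl : lam l * (τ / 2 * U) ≤ |b.repr g l| := by
    have h2 := abs_sub_abs_le_abs_sub (lam l * b.repr e l) (b.repr g l)
    rw [abs_sub_comm, abs_mul, abs_of_pos hlam0] at h2
    have h3 := herr l
    have h4 : lam l * (τ * U) ≤ lam l * |b.repr e l| := by gcongr
    have h5 : lam l * (p * U) ≤ lam l * (τ / 2 * U) := by gcongr; linarith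
    linarith
  have hgl2 : (lam l * (τ / 2 * U)) ^ 2 ≤ (b.repr g l) ^ 2 := by
    rw [← sq_abs (b.repr g l)]; gcongr
  have hsum : slowEnergy b lam l g ≤ N * (2 * (lam l * (p * U))) ^ 2 := by
    rw [slowEnergy]
    calc ∑ i with lam i < lam l, (b.repr g i) ^ 2
        ≤ (Finset.univ.filter fun i => lam i < lam l).card • (2 * (lam l * (p * U))) ^ 2 :=
          Finset.sum_le_card_nsmul _ _ _ fun j hj => hlowg j (Finset.mem_filter.1 hj).2
      _ ≤ N * (2 * (lam l * (p * U))) ^ 2 := by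
          rw [nsmul_eq_mul]
          gcongr
          rw [hN]
          exact_mod_cast Finset.card_le_univ _
  have hcmp : N * (2 * (lam l * (p * U))) ^ 2 ≤ (lam l * (τ / 2 * U)) ^ 2 / 16 := by
    rw [← hpτ]
    have : 0 ≤ (lam l * (p * U)) ^ 2 := by positivity
    nlinarith [mul_nonneg this hN0, mul_nonneg this (mul_nonneg hN0 hN0)]
  linarith

/-- Weights that grow by the factor `1 / p` at least when the value of `lam` increases. -/
theorem exists_geometric_weights (lam : ι → ℝ) {p : ℝ} (hp0 : 0 < p) (hp1 : p ≤ 1) :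
    ∃ c : ι → ℝ, (∀ l, 1 ≤ p * c l) ∧ ∀ j l, lam j < lam l → c j ≤ p * c l := by
  -- Only strictly smaller eigenvalues count, so equal eigenvalues get equal weights.
  let rank : ι → ℕ := fun l => (Finset.univ.filter fun j => lam j < lam l).card
  have hrank : ∀ j l, lam j < lam l → rank j < rank l := by
    intro j l hjl
    refine Finset.card_lt_card (Finset.ssubset_iff_of_subset ?_ |>.2 ⟨j, ?_, ?_⟩)
    · intro i hi
      simp only [Finset.mem_filter, Finset.mem_univ, true_and] at hi ⊢
      exact hi.trans hjl
    · simpa using hjl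
    · simp
  have hp_inv : 1 ≤ 1 / p := by rw [le_div_iff₀ hp0]; linarith
  have hpc : ∀ l, p * (1 / p) ^ (rank l + 1) = (1 / p) ^ rank l := by
    intro l; rw [pow_succ]; field_simp
  refine ⟨fun l => (1 / p) ^ (rank l + 1), fun l => ?_, fun j l hjl => ?_⟩
  · rw [hpc]; exact one_le_pow₀ hp_inv
  · rw [hpc]; exact pow_le_pow_right₀ hp_inv (hrank j l hjl)

set_option maxHeartbeats 1000000 in
/-- Near spectral step-sizes give R-linear decay of a gradient recursion whose field `G` is,
near the origin, a small perturbation of a positive definite linear map. -/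
theorem DiagonalizedBy.exists_linear_rate (hA : DiagonalizedBy A b lam μ L) (hμ : 0 < μ)
    (hμL : μ ≤ L) :
    ∃ θ C ε : ℝ, 0 < θ ∧ θ < 1 ∧ 1 ≤ C ∧ 0 < ε ∧
      ∀ (R E : ℝ) (G : V → V) (e : ℕ → V) (α : ℕ → ℝ), 0 < E → C * E < R →
        (∀ v, ‖v‖ < R → ‖G v - A v‖ ≤ ε * ‖v‖) →
        (∀ k, e (k + 1) = e k - α k • G (e k)) →
        0 < α 0 →
        (∀ k, ‖e k‖ < R → ‖e (k + 1)‖ < R → 0 < α k → G (e k) ≠ 0 →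
          IsNearSpectralStep A ε (e (k + 1) - e k) (α (k + 1))) →
        ‖e 0‖ ≤ E → ‖e 1‖ ≤ E → ∀ k, ‖e k‖ ≤ C * θ ^ k * E := by
  have hL : 0 < L := hμ.trans_le hμL
  obtain ⟨a, ha⟩ : ∃ a, a = μ / (8 * L ^ 2) := ⟨_, rfl⟩
  obtain ⟨β, hβ⟩ : ∃ β, β = 8 * L / μ ^ 2 := ⟨_, rfl⟩
  have ha0 : 0 < a := by rw [ha]; positivity
  have hβ0 : 0 < β := by rw [hβ]; positivity
  have haμ : a * μ ≤ 1 / 8 := by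
    rw [ha, div_mul_eq_mul_div, div_le_div_iff₀ (by positivity) (by norm_num)]
    nlinarith
  -- K bounds the growth factor |1 - tλ_l| for every t in [a, β].
  obtain ⟨K, hK⟩ : ∃ K, K = 1 + β * L := ⟨_, rfl⟩
  have hβL : 0 < β * L := by positivity
  have hK1 : 1 ≤ K := by linarith
  -- Two growth steps from τU, errors included, give at most 3K²τU = U/4 ≤ θ²U.
  obtain ⟨τ, hτ⟩ : ∃ τ, τ = 1 / (12 * K ^ 2) := ⟨_, rfl⟩
  have hτ0 : 0 < τ := by rw [hτ]; positivity
  have hτK : τ * (12 * K ^ 2) = 1 := by rw [hτ]; field_simp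
  obtain ⟨p, hp⟩ : ∃ p, p = τ / (16 * ((Fintype.card ι : ℝ) + 1)) := ⟨_, rfl⟩
  have hp0 : 0 < p := by rw [hp]; positivity
  have hpτ : p ≤ τ / 16 := by
    rw [hp]
    gcongr
    have : (0 : ℝ) ≤ Fintype.card ι := by positivity
    linarith
  have hKτ : K * τ * 12 ≤ 1 := by nlinarith only [hτK, mul_pos hτ0 (zero_lt_one.trans_le hK1), hK1]
  have hpK : 8 * K * p ≤ 1 := by nlinarith only [hKτ, hpτ, hK1, hp0, hτ0]
  have hp1 : p ≤ 1 := by nlinarith only [hpK, hK1, hp0]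
  -- Contraction gives 1 - aμ; half of the gain is left for the nonlinear error, which σ keeps below
  -- aμ/2.
  obtain ⟨θ, hθ⟩ : ∃ θ, θ = 1 - a * μ / 2 := ⟨_, rfl⟩
  have haμ0 : 0 < a * μ := by positivity
  have hθ1 : θ < 1 := by linarith
  have hθ2 : 1 / 2 ≤ θ := by linarith
  have hθ0 : 0 < θ := by linarith
  obtain ⟨σ, hσ⟩ : ∃ σ, σ = min p (a * μ / (2 * K)) := ⟨_, rfl⟩
  have hσ0 : 0 < σ := by rw [hσ]; exact lt_min hp0 (by positivity)
  have hσp : σ ≤ p := hσ ▸ min_le_left _ _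
  have hKσ : K * σ ≤ a * μ / 2 := by
    have : σ ≤ a * μ / (2 * K) := hσ ▸ min_le_right _ _
    calc K * σ ≤ K * (a * μ / (2 * K)) := by gcongr
      _ = a * μ / 2 := by field_simp
  obtain ⟨c, hcp, hcj⟩ := exists_geometric_weights lam hp0 hp1
  have hc1 : ∀ l, 1 ≤ c l := by
    intro l
    have h0 : 0 < c l := pos_of_mul_pos_right (zero_lt_one.trans_le (hcp l)) hp0.le
    exact (hcp l).trans (mul_le_of_le_one_left h0.le hp1)
  have hcK : ∀ l, 8 * K ≤ c l := by
    intro l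
    have h1 := hcp l
    have h2 := hc1 l
    calc 8 * K = 8 * K * 1 := by ring
      _ ≤ 8 * K * (p * c l) := by gcongr
      _ = 8 * K * p * c l := by ring
      _ ≤ 1 * c l := by gcongr
      _ = c l := one_mul _
  obtain ⟨C, hC⟩ : ∃ C, C = 1 + ∑ l, c l := ⟨_, rfl⟩
  have hC1 : 1 ≤ C := by
    have : 0 ≤ ∑ l, c l := Finset.sum_nonneg fun l _ => by linarith [hc1 l]
    linarith
  refine ⟨θ, C, μ * σ / C, hθ0, hθ1, hC1, by positivity, ?_⟩
  obtain ⟨ε, hε⟩ : ∃ ε, ε = μ * σ / C := ⟨_, rfl⟩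
  rw [← hε]
  have hε0 : 0 < ε := by rw [hε]; positivity
  have hεC : ε * C = μ * σ := by rw [hε]; field_simp
  have hεμ : ε ≤ μ / 16 := by
    have hσ16 : σ ≤ 1 / 16 := by
      have : τ ≤ 1 := by nlinarith only [hτK, hτ0, hK1]
      linarith
    calc ε = ε * 1 := by ring
      _ ≤ ε * C := by gcongr
      _ = μ * σ := hεC
      _ ≤ μ * (1 / 16) := by gcongr
      _ = μ / 16 := by ring
  have hβμ : β * μ ≤ K := by
    have : β * μ ≤ β * L := by gcongr
    linarith
  intro R E G e α hE hCE hG he hα0 hstep he0 he1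
  -- from the componentwise bounds to the norm
  have hnorm : ∀ k, (∀ l, |b.repr (e k) l| ≤ c l * θ ^ k * E) → ‖e k‖ ≤ C * θ ^ k * E := by
    intro k hk
    calc ‖e k‖ ≤ ∑ l, |b.repr (e k) l| := norm_le_sum_abs_repr b _
      _ ≤ ∑ l, c l * θ ^ k * E := Finset.sum_le_sum fun l _ => hk l
      _ = (∑ l, c l) * θ ^ k * E := by rw [Finset.sum_mul, Finset.sum_mul]
      _ ≤ C * θ ^ k * E := by gcongr; linarith
  have hlt : ∀ k, ‖e k‖ ≤ C * θ ^ k * E → ‖e k‖ < R := by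
    intro k hk
    refine hk.trans_lt (lt_of_le_of_lt ?_ hCE)
    have : θ ^ k ≤ 1 := pow_le_one₀ hθ0.le hθ1.le
    calc C * θ ^ k * E ≤ C * 1 * E := by gcongr
      _ = C * E := by ring
  have hGerr : ∀ k, ‖e k‖ ≤ C * θ ^ k * E → ‖G (e k) - A (e k)‖ ≤ μ * (σ * (θ ^ k * E)) := by
    intro k hk
    calc ‖G (e k) - A (e k)‖ ≤ ε * ‖e k‖ := hG _ (hlt k hk)
      _ ≤ ε * (C * θ ^ k * E) := by gcongr
      _ = (ε * C) * (θ ^ k * E) := by ring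
      _ = _ := by rw [hεC]; ring
  have hGzero : ∀ v, ‖v‖ < R → G v = 0 → v = 0 := by
    intro v hv hv0
    have h1 := hG v hv
    rw [hv0, zero_sub, norm_neg] at h1
    have h2 := hA.mul_norm_le_norm hμ v
    have h3 : ε * ‖v‖ ≤ μ / 16 * ‖v‖ := by gcongr
    have h4 : ‖v‖ ≤ 0 := by nlinarith only [norm_nonneg v, h1, h2, h3, hμ]
    exact norm_le_zero_iff.1 h4
  have hαpos : ∀ k, ‖e k‖ < R → ‖e (k + 1)‖ < R → 0 < α k → G (e k) ≠ 0 →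
      α (k + 1) ∈ Set.Icc a β := by
    intro k hk hk1 hαk hGk
    rw [ha, hβ]
    refine (hstep k hk hk1 hαk hGk).mem_Icc hA hμ hμL (by linarith) ?_
    rw [he k]
    simpa [hαk.ne'] using hGk
  have hcrude : ∀ t l, t ∈ Set.Icc a β → |1 - t * lam l| ≤ K := by
    intro t l ht
    have hl1 := hA.le_eigenvalue l
    have hl2 := hA.eigenvalue_le l
    have : t * lam l ≤ β * L := mul_le_mul ht.2 hl2 (by linarith) hβ0.le
    have : 0 ≤ t * lam l := mul_nonneg (ha0.le.trans ht.1) (by linarith)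
    rw [abs_le]; constructor <;> linarith
  have hgrow : ∀ k l X, α k ∈ Set.Icc a β → ‖e k‖ ≤ C * θ ^ k * E →
      |b.repr (e k) l| ≤ X → |b.repr (e (k + 1)) l| ≤ K * X + K * (σ * (θ ^ k * E)) := by
    intro k l X hk hek hX
    have hα := ha0.le.trans hk.1
    rw [he k]
    refine (hA.abs_repr_sub_smul_le hα (hGerr k hek) l).trans (add_le_add ?_ ?_)
    · exact mul_le_mul (hcrude _ l hk) hX (abs_nonneg _) (by linarith)
    · calc α k * (μ * (σ * (θ ^ k * E))) ≤ β * (μ * (σ * (θ ^ k * E))) := by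
            gcongr; exact hk.2
        _ = β * μ * (σ * (θ ^ k * E)) := by ring
        _ ≤ _ := by gcongr
  -- invariant: component bounds at `k` and `k + 1`, and control of the step-size
  suffices hinv : ∀ k, (∀ l, |b.repr (e k) l| ≤ c l * θ ^ k * E) ∧
      (∀ l, |b.repr (e (k + 1)) l| ≤ c l * θ ^ (k + 1) * E) ∧
      (G (e k) ≠ 0 → 0 < α k ∧ (k ≠ 0 → α k ∈ Set.Icc a β)) by
    exact fun k => hnorm k (hinv k).1
  intro k
  induction k with
  | zero =>
    refine ⟨fun l => ?_, fun l => ?_, fun _ => ⟨hα0, fun h => absurd rfl h⟩⟩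
    · refine (abs_repr_le_norm b _ l).trans (he0.trans ?_)
      simpa using mul_le_mul_of_nonneg_right (hc1 l) hE.le
    · refine (abs_repr_le_norm b _ l).trans (he1.trans ?_)
      have : 1 ≤ c l * θ ^ (0 + 1) := by
        simp only [zero_add, pow_one]; nlinarith only [hcK l, hK1, hθ2]
      simpa using mul_le_mul_of_nonneg_right this hE.le
  | succ k ih =>
    obtain ⟨ih0, ih1, ihα⟩ := ih
    have hn0 := hnorm k ih0
    have hn1 := hnorm (k + 1) ih1
    have hR0 := hlt k hn0
    have hR1 := hlt (k + 1) hn1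
    -- After termination the step-size is uncontrolled, but the error is exactly zero.
    by_cases hGk : G (e k) = 0
    · have hz : e k = 0 := hGzero _ hR0 hGk
      have hz1 : e (k + 1) = 0 := by rw [he, hGk, hz]; simp
      have hG1 : G (e (k + 1)) = 0 := by rw [hz1]; rwa [hz] at hGk
      have hz2 : e (k + 1 + 1) = 0 := by rw [he, hG1, hz1]; simp
      refine ⟨ih1, fun l => ?_, fun h => absurd hG1 h⟩
      have := hc1 l
      rw [hz2]
      simp only [map_zero, PiLp.zero_apply, abs_zero]
      positivity
    obtain ⟨hαk, hαk'⟩ := ihα hGk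
    have hα1 := hαpos k hR0 hR1 hαk hGk
    refine ⟨ih1, fun l => ?_, fun _ => ⟨ha0.trans_le hα1.1, fun _ => hα1⟩⟩
    have hcl := hc1 l
    have hθk : 0 < θ ^ k := pow_pos hθ0 k
    rcases Nat.eq_zero_or_pos k with rfl | hkpos
    · -- the step-size `α 0` is unrestricted
      have hX : |b.repr (e (0 + 1)) l| ≤ E := (abs_repr_le_norm b _ l).trans he1
      have h1 := hgrow (0 + 1) l E hα1 hn1 hX
      have h2 : σ * (θ ^ (0 + 1) * E) ≤ 1 * (1 * E) := by
        gcongr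
        · linarith
        · simpa using hθ1.le
      have h3 : K * (σ * (θ ^ (0 + 1) * E)) ≤ K * (1 * (1 * E)) := by gcongr
      -- The initial size 8K of the weights absorbs one growth step.
      have h4 : 2 * K ≤ c l * θ ^ (0 + 1 + 1) := by
        have : (1 / 2 : ℝ) ^ 2 ≤ θ ^ 2 := by gcongr
        calc 2 * K = 8 * K * (1 / 2) ^ 2 := by ring
          _ ≤ c l * θ ^ 2 := by gcongr; exact hcK l
      nlinarith only [mul_le_mul_of_nonneg_right h4 hE.le, h1, h3]
    have hU : 0 < c l * θ ^ k * E := by positivity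
    have hσU : σ * (θ ^ k * E) ≤ p * (c l * θ ^ k * E) := by
      calc σ * (θ ^ k * E) ≤ p * (θ ^ k * E) := by gcongr
        _ = p * (1 * θ ^ k * E) := by ring
        _ ≤ _ := by gcongr
    have hσU1 : σ * (θ ^ (k + 1) * E) ≤ σ * (θ ^ k * E) := by
      rw [pow_succ]
      gcongr
      exact mul_le_of_le_one_right hθk.le hθ1.le
    by_cases hcase : |b.repr (e k) l| ≤ τ * (c l * θ ^ k * E)
    · have h1 := hgrow k l _ (hαk' hkpos.ne') hn0 hcase
      have h2 := hgrow (k + 1) l _ hα1 hn1 h1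
      set U := c l * θ ^ k * E with hUdef
      have h3 : σ * (θ ^ k * E) ≤ τ * U := hσU.trans (by gcongr; linarith)
      have h4 : K * (K * (τ * U) + K * (σ * (θ ^ k * E))) + K * (σ * (θ ^ (k + 1) * E))
          ≤ K * (K * (τ * U) + K * (τ * U)) + K * (K * (τ * U)) := by
        have h5 : σ * (θ ^ (k + 1) * E) ≤ 1 * (τ * U) := by linarith
        have h6 : σ * (θ ^ (k + 1) * E) ≤ K * (τ * U) :=
          h5.trans (by gcongr)
        gcongr
      have h7 : K * (K * (τ * U) + K * (τ * U)) + K * (K * (τ * U)) = (1 / 4) * U := by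
        linear_combination (U / 4) * hτK
      have h8 : (1 / 4) * U ≤ θ ^ 2 * U := by gcongr; nlinarith only [hθ2]
      have h9 : c l * θ ^ (k + 1 + 1) * E = θ ^ 2 * U := by rw [hUdef]; ring
      rw [h9]
      linarith
    · have hs : slowEnergy b lam l (G (e k)) ≤ (b.repr (G (e k)) l) ^ 2 / 16 := by
        refine hA.slowEnergy_le_of_dominant hμ hτ0 hU hp (hGerr k hn0) ?_ ?_ (not_le.1 hcase).le
        · gcongr
        · intro j hj
          refine (ih0 j).trans ?_
          calc c j * θ ^ k * E ≤ (p * c l) * θ ^ k * E := by gcongr; exact hcj j l hj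
            _ = _ := by ring
      have hdiff : e (k + 1) - e k = (-α k) • G (e k) := by rw [he k]; simp
      have hαl : α (k + 1) * lam l ≤ 3 / 2 := by
        refine (hstep k hR0 hR1 hαk hGk).mul_eigenvalue_le hA hμ hεμ ?_ ?_
        · rw [hdiff]; simpa [hαk.ne'] using hGk
        · rw [hdiff, slowEnergy_smul, map_smul, PiLp.smul_apply, smul_eq_mul, mul_pow,
            mul_div_assoc]
          gcongr
      have hαl' : a * μ ≤ α (k + 1) * lam l :=
        mul_le_mul hα1.1 (hA.le_eigenvalue l) hμ.le (ha0.le.trans hα1.1)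
      have hcon : |1 - α (k + 1) * lam l| ≤ 1 - a * μ := by
        rw [abs_le]; constructor <;> linarith
      rw [he (k + 1)]
      have h1 := hA.abs_repr_sub_smul_le (ha0.le.trans hα1.1) (hGerr (k + 1) hn1) l
      refine h1.trans ?_
      have h2 : α (k + 1) * (μ * (σ * (θ ^ (k + 1) * E))) ≤
          a * μ / 2 * (c l * θ ^ (k + 1) * E) := by
        calc α (k + 1) * (μ * (σ * (θ ^ (k + 1) * E)))
            ≤ β * (μ * (σ * (θ ^ (k + 1) * E))) := by gcongr; exact hα1.2
          _ = β * μ * σ * (1 * θ ^ (k + 1) * E) := by ring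
          _ ≤ K * σ * (c l * θ ^ (k + 1) * E) := by gcongr
          _ ≤ _ := by gcongr
      have h3 : |1 - α (k + 1) * lam l| * |b.repr (e (k + 1)) l| ≤
          (1 - a * μ) * (c l * θ ^ (k + 1) * E) :=
        mul_le_mul hcon (ih1 l) (abs_nonneg _) (by linarith)
      have h4 : c l * θ ^ (k + 1 + 1) * E = θ * (c l * θ ^ (k + 1) * E) := by ring
      rw [h4, hθ]
      rw [hθ] at h2 h3
      linarith

end Recursion

/-! ### Taylor estimates and the KGD step-sizes. -/

section Calculus

variable {n : ℕ} {f : EuclideanSpace ℝ (Fin n) → ℝ}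

theorem contDiff_gradient (hf : ContDiff ℝ 2 f) : ContDiff ℝ 1 (gradient f) :=
  (InnerProductSpace.toDual ℝ (EuclideanSpace ℝ (Fin n))).symm.contDiff.comp
    (hf.fderiv_right (m := 1) (by norm_num))

theorem inner_hessian_apply (hf : ContDiff ℝ 2 f) (x v w : EuclideanSpace ℝ (Fin n)) :
    ⟪hessian f x v, w⟫_ℝ = fderiv ℝ (fderiv ℝ f) x v w := by
  have hG : HasFDerivAt (gradient f) (hessian f x) x :=
    ((contDiff_gradient hf).differentiable (by norm_num) x).hasFDerivAt
  have hcomp := (InnerProductSpace.toDual ℝ (EuclideanSpace ℝ (Fin n))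
    ).toContinuousLinearEquiv.toContinuousLinearMap.hasFDerivAt.comp x hG
  have hfun : (InnerProductSpace.toDual ℝ (EuclideanSpace ℝ (Fin n))
    ).toContinuousLinearEquiv.toContinuousLinearMap ∘ gradient f = fderiv ℝ f :=
    toDual_comp_gradient
  rw [hfun] at hcomp
  rw [hcomp.fderiv]
  rfl

theorem hessian_isSymmetric (hf : ContDiff ℝ 2 f) (x : EuclideanSpace ℝ (Fin n)) :
    (hessian f x : EuclideanSpace ℝ (Fin n) →ₗ[ℝ] EuclideanSpace ℝ (Fin n)).IsSymmetric := by
  intro v w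
  have hsymm : IsSymmSndFDerivAt ℝ f x := hf.contDiffAt.isSymmSndFDerivAt (by simp)
  change ⟪hessian f x v, w⟫_ℝ = ⟪v, hessian f x w⟫_ℝ
  rw [real_inner_comm v (hessian f x w) |>.symm, inner_hessian_apply hf, inner_hessian_apply hf]
  exact hsymm v w

theorem exists_diagonalizedBy_hessian (hf : ContDiff ℝ 2 f) {x : EuclideanSpace ℝ (Fin n)} {μ : ℝ}
    (hμ : ∀ v, μ * ‖v‖ ^ 2 ≤ ⟪v, hessian f x v⟫_ℝ) :
    ∃ (b : OrthonormalBasis (Fin n) ℝ (EuclideanSpace ℝ (Fin n))) (lam : Fin n → ℝ) (L : ℝ),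
      μ ≤ L ∧ DiagonalizedBy (hessian f x) b lam μ L := by
  have hT := hessian_isSymmetric hf x
  have hn : Module.finrank ℝ (EuclideanSpace ℝ (Fin n)) = n := by simp
  set b := hT.eigenvectorBasis hn
  set lam := hT.eigenvalues hn
  have hb : ∀ i, hessian f x (b i) = lam i • b i := fun i =>
    hT.apply_eigenvectorBasis hn i
  have hq : ∀ i, ⟪b i, hessian f x (b i)⟫_ℝ = lam i := fun i => by
    rw [hb, inner_smul_right, real_inner_self_eq_norm_sq, b.norm_eq_one]; simp
  -- The maximum secures μ ≤ L also in dimension zero.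
  refine ⟨b, lam, max μ ‖hessian f x‖, le_max_left _ _, ⟨fun v i => ?_, fun i => ?_, fun i => ?_⟩⟩
  · simpa using hT.eigenvectorBasis_apply_self_apply hn v i
  · simpa [hq i] using hμ (b i)
  · refine le_trans ?_ (le_max_right _ _)
    rw [← hq i]
    refine (real_inner_le_norm _ _).trans ?_
    simpa using (hessian f x).le_opNorm (b i)

variable {a : EuclideanSpace ℝ (Fin n)} {R ε : ℝ}
  {A : EuclideanSpace ℝ (Fin n) →L[ℝ] EuclideanSpace ℝ (Fin n)}

theorem norm_gradient_sub_sub_le (hf : ContDiff ℝ 2 f)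
    (hA : ∀ z ∈ Metric.ball a R, ‖hessian f z - A‖ ≤ ε) {x y : EuclideanSpace ℝ (Fin n)}
    (hx : x ∈ Metric.ball a R) (hy : y ∈ Metric.ball a R) :
    ‖gradient f y - gradient f x - A (y - x)‖ ≤ ε * ‖y - x‖ :=
  (convex_ball a R).norm_image_sub_le_of_norm_fderiv_le'
    (fun z _ => (contDiff_gradient hf).differentiable (by norm_num) z) hA hx hy

theorem abs_taylor_sub_le (hf : ContDiff ℝ 2 f) (hε : 0 ≤ ε)
    (hA : ∀ z ∈ Metric.ball a R, ‖hessian f z - A‖ ≤ ε) {x y : EuclideanSpace ℝ (Fin n)}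
    (hx : x ∈ Metric.ball a R) (hy : y ∈ Metric.ball a R) :
    |f y - f x - ⟪gradient f x, y - x⟫_ℝ - ⟪y - x, A (y - x)⟫_ℝ / 2| ≤ ε * ‖y - x‖ ^ 2 := by
  set s := y - x with hs
  -- The Taylor error along the segment, with A in place of the Hessian at x; its derivative is a
  -- gradient linearization error.
  let φ : ℝ → ℝ := fun t =>
    f (x + t • s) - t * ⟪gradient f x, s⟫_ℝ - t ^ 2 * (⟪s, A s⟫_ℝ / 2)
  have hline : ∀ t : ℝ, HasDerivAt (fun t : ℝ => x + t • s) s t := fun t => by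
    simpa using ((hasDerivAt_id t).smul_const s).const_add x
  have hφ : ∀ t : ℝ, HasDerivAt φ
      (⟪gradient f (x + t • s) - gradient f x - A (t • s), s⟫_ℝ) t := by
    intro t
    have hf' : HasDerivAt (fun t : ℝ => f (x + t • s)) (⟪gradient f (x + t • s), s⟫_ℝ) t := by
      rw [inner_gradient_left]
      exact ((hf.differentiable (by norm_num) (x + t • s)).hasFDerivAt).comp_hasDerivAt t (hline t)
    have h1 := (hasDerivAt_id t).mul_const (⟪gradient f x, s⟫_ℝ)
    have h2 := (hasDerivAt_pow 2 t).mul_const (⟪s, A s⟫_ℝ / 2)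
    refine ((hf'.sub h1).sub h2).congr_deriv ?_
    rw [inner_sub_left (gradient f (x + t • s) - gradient f x),
      inner_sub_left (gradient f (x + t • s)), map_smul, real_inner_smul_left,
      real_inner_comm s (A s)]
    push_cast
    ring
  have hbound : ∀ t ∈ Set.Ico (0 : ℝ) 1,
      ‖⟪gradient f (x + t • s) - gradient f x - A (t • s), s⟫_ℝ‖ ≤ ε * ‖s‖ ^ 2 := by
    intro t ht
    have hmem : x + t • s ∈ Metric.ball a R := by
      have := (convex_ball a R).add_smul_sub_mem hx hy ⟨ht.1, ht.2.le⟩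
      simpa [hs] using this
    have h1 := norm_gradient_sub_sub_le hf hA hx hmem
    rw [add_sub_cancel_left] at h1
    have h2 : ‖t • s‖ ≤ ‖s‖ := by
      rw [norm_smul, Real.norm_of_nonneg ht.1]
      exact mul_le_of_le_one_left (norm_nonneg _) ht.2.le
    calc _ ≤ ‖gradient f (x + t • s) - gradient f x - A (t • s)‖ * ‖s‖ := norm_inner_le_norm _ _
      _ ≤ ε * ‖t • s‖ * ‖s‖ := by gcongr
      _ ≤ ε * ‖s‖ * ‖s‖ := by gcongr
      _ = _ := by ring
  have := norm_image_sub_le_of_norm_deriv_le_segment_01'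
    (fun t _ => (hφ t).hasDerivWithinAt) hbound
  have hval : φ 1 - φ 0 =
      f y - f x - ⟪gradient f x, s⟫_ℝ - ⟪s, A s⟫_ℝ / 2 := by
    simp only [φ, hs]
    simp
    ring
  rwa [hval, Real.norm_eq_abs] at this

/-- Since ⟪G, s⟫ = -α‖G‖², the numerator of the short step is twice the second-order Taylor term;
the doubling is why the Hessian must vary by at most ε/2. -/
theorem isNearSpectralStep_kgdStep (hf : ContDiff ℝ 2 f) (hε : 0 ≤ ε)
    (hA : ∀ z ∈ Metric.ball a R, ‖hessian f z - A‖ ≤ ε / 2) (kind : KGDKind)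
    {x y : EuclideanSpace ℝ (Fin n)} {α : ℝ} (hα : 0 < α) (hxy : y = x - α • gradient f x)
    (hG : gradient f x ≠ 0) (hx : x ∈ Metric.ball a R) (hy : y ∈ Metric.ball a R) :
    IsNearSpectralStep A ε (y - x) (kgdStep f kind y x α) := by
  have hs : y - x = -(α • gradient f x) := by rw [hxy]; abel
  have hN : 0 < ‖gradient f x‖ := norm_pos_iff.2 hG
  have hinner : ⟪gradient f x, y - x⟫_ℝ = -(α * ‖gradient f x‖ ^ 2) := by
    rw [hs, inner_neg_right, inner_smul_right, real_inner_self_eq_norm_sq]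
  have hnorm : ‖y - x‖ ^ 2 = α ^ 2 * ‖gradient f x‖ ^ 2 := by
    rw [hs, norm_neg, norm_smul, Real.norm_of_nonneg hα.le, mul_pow]
  refine ⟨2 * (α * ‖gradient f x‖ ^ 2 + (f y - f x)), gradient f y - gradient f x, ?_, ?_, ?_⟩
  · have h := abs_taylor_sub_le hf (by positivity) hA hx hy
    rw [hinner] at h
    rw [abs_le] at h ⊢
    constructor <;> linarith
  · refine (norm_gradient_sub_sub_le hf hA hx hy).trans ?_
    gcongr
    linarith
  · cases kind with
    | long =>
      left
      rw [hnorm]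
      have h : 2 + 2 * (f y - f x) / (α * ‖gradient f x‖ ^ 2) =
          2 * (α * ‖gradient f x‖ ^ 2 + (f y - f x)) / (α * ‖gradient f x‖ ^ 2) := by
        field_simp
      simp only [kgdStep, longKGD]
      rw [h, div_div_eq_mul_div]
      ring
    | short => exact Or.inr rfl

end Calculus

/-! ### Local R-linear convergence of KGD. -/

theorem mainTheorem3 {n : ℕ} (f : EuclideanSpace ℝ (Fin n) → ℝ) (hf : ContDiff ℝ 3 f)
    (xstar : EuclideanSpace ℝ (Fin n)) (hmin : IsLocalMin f xstar)
    (ρ Λ₂ : ℝ) (hρ : 0 < ρ) (hΛ₂ : 0 < Λ₂)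
    (hconv : ∀ x ∈ Metric.ball xstar ρ, ∀ v : EuclideanSpace ℝ (Fin n),
      Λ₂ * ‖v‖ ^ 2 ≤ inner ℝ v (hessian f x v)) :
    ∃ r : ℝ, 0 < r ∧ r < ρ ∧
      ∀ δ : ℝ, 0 < δ → δ < r →
        ∀ (kind : KGDKind) (x : ℕ → EuclideanSpace ℝ (Fin n)) (α : ℕ → ℝ),
          IsKGDIteration f kind x α →
          IsCompact {y : EuclideanSpace ℝ (Fin n) | f y ≤ f (x 0)} →
          x 0 ∈ Metric.ball xstar δ → x 1 ∈ Metric.ball xstar δ →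
          ConvergesRLinearly x xstar := by
  have hf2 : ContDiff ℝ 2 f := hf.of_le (by norm_num)
  obtain ⟨b, lam, L, hΛL, hdiag⟩ :=
    exists_diagonalizedBy_hessian hf2 (hconv xstar (Metric.mem_ball_self hρ))
  obtain ⟨θ, C, ε, hθ0, hθ1, hC1, hε, hrate⟩ := hdiag.exists_linear_rate hΛ₂ hΛL
  have hcont : Continuous (hessian f) := (contDiff_gradient hf2).continuous_fderiv (by norm_num)
  obtain ⟨R, hR0, hR⟩ := Metric.continuous_iff.1 hcont xstar (ε / 2) (by positivity)
  have hA : ∀ z ∈ Metric.ball xstar R, ‖hessian f z - hessian f xstar‖ ≤ ε / 2 := fun z hz => by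
    rw [← dist_eq_norm]; exact (hR z hz).le
  have hcrit : gradient f xstar = 0 := by
    simp [gradient, hmin.fderiv_eq_zero]
  have hC0 : 0 < C := zero_lt_one.trans_le hC1
  -- R / C keeps all iterates, bounded by Cδ, where the Hessian is ε/2-close to that at `xstar`; ρ /
  -- 2 gives r < ρ.
  refine ⟨min (R / C) (ρ / 2), lt_min (by positivity) (by positivity),
    (min_le_right _ _).trans_lt (by linarith), ?_⟩
  intro δ hδ hδr kind x α hit _ hx0 hx1
  have hCδ : C * δ < R := by
    have := hδr.trans_le (min_le_left _ _)
    rwa [lt_div_iff₀' hC0] at this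
  have hmem : ∀ k, ‖x k - xstar‖ < R → x k ∈ Metric.ball xstar R := fun k hk => by
    rwa [Metric.mem_ball, dist_eq_norm]
  have hbound : ∀ k, ‖x k - xstar‖ ≤ C * θ ^ k * δ := by
    refine hrate R δ (fun v => gradient f (xstar + v)) (fun k => x k - xstar) α hδ hCδ
      ?_ ?_ hit.init_pos ?_ ?_ ?_
    · intro v hv
      have hv' : xstar + v ∈ Metric.ball xstar R := by
        rwa [Metric.mem_ball, dist_eq_norm, add_sub_cancel_left]
      have h := norm_gradient_sub_sub_le hf2 hA (Metric.mem_ball_self hR0) hv'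
      rw [hcrit, sub_zero, add_sub_cancel_left] at h
      refine h.trans ?_
      gcongr
      linarith
    · intro k
      simp only [add_sub_cancel]
      rw [hit.iterate k]
      abel
    · intro k hk hk1 hαk hGk
      simp only [add_sub_cancel] at hGk
      simp only [sub_sub_sub_cancel_right]
      rw [hit.stepsize k hGk]
      exact isNearSpectralStep_kgdStep hf2 hε.le hA kind hαk (hit.iterate k) hGk
        (hmem k hk) (hmem (k + 1) hk1)
    · rw [Metric.mem_ball, dist_eq_norm] at hx0; exact hx0.le
    · rw [Metric.mem_ball, dist_eq_norm] at hx1; exact hx1.le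
  have hbound' : ∀ k, ‖x k - xstar‖ ≤ C * δ * θ ^ k := fun k => by
    rw [mul_right_comm]; exact hbound k
  refine ⟨?_, C * δ, θ, hθ0, hθ1, hbound'⟩
  rw [tendsto_iff_norm_sub_tendsto_zero]
  refine squeeze_zero (fun _ => norm_nonneg _) hbound' ?_
  simpa using (tendsto_pow_atTop_nhds_zero_of_lt_one hθ0.le hθ1).const_mul (C * δ)
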